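/- Conventions. Finite simple graphs are identified with the simplicial complexes of their complete subgraphs. The unit sphere $S(v)$ of a vertex $v$ of a graph is the subgraph induced on the neighbors of $v$. A graph is contractible if it is a single point, or if it has a vertex $v$ such that both $S(v)$ and the graph with $v$ removed are contractible. The empty graph is the $(-1)$-sphere; a graph is a $d$-manifold if all its unit spheres are $(d-1)$-spheres, and for $d\ge 0$ a $d$-sphere is a $d$-manifold that becomes contractible after removing some vertex. A $d$-manifold with boundary is a graph in which every unit sphere is a $(d-1)$-sphere or a $(d-1)$-ball; its boundary is the subgraph induced on the vertices whose unit sphere is not a $(d-1)$-sphere; and for $d\ge0$ a $d$-ball is a contractible $d$-manifold with boundary whose boundary is a $(d-1)$-sphere. For a finite abstract simplicial complex $G$, the unit sphere of a simplex $x\in G$ is the graph whose vertices are the simplices of $G$ that strictly contain $x$ or are strictly contained in $x$, two being connected if one is contained in the other; $G$ is a $d$-manifold if all unit spheres of its simplices are $(d-1)$-spheres. Let $d,k\ge 0$ be integers, let $G$ be a finite abstract simplicial complex that is a $d$-manifold, and let $P=K_{(n_0,\dots,n_k)}$ with all $n_j\ge 1$ be the partition complex, that is, the complex of all complete subgraphs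 of the complete $(k+1)$-partite graph with parts of sizes $n_0,\dots,n_k$. Let $f:V(G)\to V(P)$ be a map of the vertex sets that is $P$-onto, meaning that $f(V(G))$ contains the vertices of some $k$-simplex of $P$. For a facet (maximal simplex) $y$ of $P$, let the patch $f^{-1}(y)$ be the set of simplices $x\in G$ with $f(x)\supseteq y$, and let $U$ be the set of simplices $x\in G$ such that $f(x)$ contains some facet of $P$. Regard $U$ and each patch as graphs, two simplices being connected if one is contained in the other; $H(G,f,P)$ is the complex of the complete subgraphs of $U$. Then $H(G,f,P)$ is a $(d-k)$-manifold or empty; it is the union (as a complex) of the complexes of the patches $f^{-1}(y)$, where $y$ runs over the facets of $P$ with $y\subseteq f(V(G))$; and each of these patches is a $(d-k)$-manifold with boundary or empty. -/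

import Mathlib

namespace DiscreteManifold

section Graph

/-!
Finite simple graphs are handled as vertex sets `A : Set α` inside an ambient graph `Γ` on `α`:
the set `A` stands for the subgraph of `Γ` induced on `A`, which is in turn identified with its
Whitney complex, the simplicial complex of its complete subgraphs.
-/

variable {α : Type*} (Γ : SimpleGraph α)

/-- The unit sphere of `v` in `A`: the subgraph induced on the neighbors of `v` in `A`. -/
def unitSphere (A : Set α) (v : α) : Set α := A ∩ Γ.neighborSet v

/-- A graph is contractible if it is a single point, or if it has a vertex `v` such that both the
unit sphere of `v` and the graph without `v` are contractible. -/
inductive IsContractible : Set α → Prop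
  | point (v : α) : IsContractible {v}
  | step (A : Set α) (v : α) (hv : v ∈ A)
      (hS : IsContractible (unitSphere Γ A v)) (hA : IsContractible (A \ {v})) :
      IsContractible A

/-- The empty graph is the `(-1)`-sphere. For `d ≥ 0`, a `d`-sphere is a graph all of whose unit
spheres are `(d-1)`-spheres and which becomes contractible after removing some vertex. -/
inductive IsSphere : ℤ → Set α → Prop
  | empty : IsSphere (-1) ∅
  | step (d : ℤ) (A : Set α) (hd : 0 ≤ d)
      (hS : ∀ v ∈ A, IsSphere (d - 1) (unitSphere Γ A v))
      (hA : ∃ v ∈ A, IsContractible Γ (A \ {v})) :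
      IsSphere d A

/-- A `d`-manifold: all unit spheres are `(d-1)`-spheres. -/
def IsManifold (d : ℤ) (A : Set α) : Prop :=
  ∀ v ∈ A, IsSphere Γ (d - 1) (unitSphere Γ A v)

/-- The boundary points of a `d`-dimensional `A`: the vertices whose unit sphere is not a
`(d-1)`-sphere. -/
def boundary (d : ℤ) (A : Set α) : Set α :=
  {v ∈ A | ¬ IsSphere Γ (d - 1) (unitSphere Γ A v)}

/-- A `d`-ball (`d ≥ 0`): a contractible graph in which every unit sphere is a `(d-1)`-sphere or,
at the boundary points, a `(d-1)`-ball, and whose boundary is a `(d-1)`-sphere. -/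
inductive IsBall : ℤ → Set α → Prop
  | mk (d : ℤ) (A : Set α) (hd : 0 ≤ d) (hc : IsContractible Γ A)
      (hS : ∀ v ∈ boundary Γ d A, IsBall (d - 1) (unitSphere Γ A v))
      (hb : IsSphere Γ (d - 1) (boundary Γ d A)) :
      IsBall d A

/-- A `d`-manifold with boundary: every unit sphere is a `(d-1)`-sphere or a `(d-1)`-ball. -/
def IsManifoldWithBoundary (d : ℤ) (A : Set α) : Prop :=
  ∀ v ∈ A, IsSphere Γ (d - 1) (unitSphere Γ A v) ∨ IsBall Γ (d - 1) (unitSphere Γ A v)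

/-- The Whitney complex of the subgraph of `Γ` induced on `A`: its simplices are the vertex sets of
the non-empty complete subgraphs. -/
def whitneyComplex (A : Set α) : PreAbstractSimplicialComplex α where
  faces := {c | c.Nonempty ∧ (c : Set α) ⊆ A ∧ Γ.IsClique (c : Set α)}
  isRelLowerSet_faces := by
    rintro c ⟨hc, hA, hcl⟩
    refine ⟨hc, fun b hb hbn => ⟨hbn, ?_, ?_⟩⟩
    · exact (Finset.coe_subset.2 hb).trans hA
    · exact hcl.subset (Finset.coe_subset.2 hb)

end Graph

/-- The graph on finite sets in which two different sets are connected if one is contained in the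
other. -/
def inclusionGraph (V : Type*) : SimpleGraph (Finset V) :=
  SimpleGraph.fromRel fun x y => x ⊆ y

/-- The complex `G` is a `d`-manifold: for each simplex `x` of `G`, the unit sphere of `x`,
formed by the simplices of `G` strictly contained in `x` or strictly containing `x`,
is a `(d-1)`-sphere. -/
def IsManifoldComplex {V : Type*} (d : ℤ) (G : AbstractSimplicialComplex V) : Prop :=
  IsManifold (inclusionGraph V) d G.faces

/-- The partition complex of `(n 0, …, n k)`: the join of the `0`-dimensional complexes with
`n 0, …, n k` points, that is the Whitney complex of the complete multipartite graph. -/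
def partitionComplex {k : ℕ} (n : Fin (k + 1) → ℕ) :
    AbstractSimplicialComplex (Σ j, Fin (n j)) where
  toPreAbstractSimplicialComplex :=
    whitneyComplex (SimpleGraph.completeMultipartiteGraph fun j => Fin (n j)) Set.univ
  singleton_mem v := by
    refine ⟨Finset.singleton_nonempty v, Set.subset_univ _, ?_⟩
    simp

/-- The facets of a complex are its maximal simplices. -/
def IsFacet {W : Type*} (P : AbstractSimplicialComplex W) (y : Finset W) : Prop :=
  Maximal (fun z => z ∈ P.faces) y

section Pullback

variable {V W : Type*} (G : AbstractSimplicialComplex V) (f : V → W)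
  (P : AbstractSimplicialComplex W)

/-- The map `f` from the vertices of `G` to the vertices of the `k`-dimensional complex `P` is
`P`-onto: its image is `k`-dimensional, which means that it contains the vertices of a
`k`-simplex of `P`. -/
def IsOnto (k : ℕ) (f : V → W) (P : AbstractSimplicialComplex W) : Prop :=
  ∃ y ∈ P.faces, y.card = k + 1 ∧ (y : Set W) ⊆ Set.range f

/-- The set of simplices `x` of `G` such that `f(x)` contains a facet of `P`. -/
def pullbackSet : Set (Finset V) :=
  {x ∈ G.faces | ∃ y, IsFacet P y ∧ (y : Set W) ⊆ f '' (x : Set V)}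

/-- The patch `f⁻¹(y)`: the set of simplices `x` of `G` such that `f(x)` contains `y`. -/
def patchSet (y : Finset W) : Set (Finset V) :=
  {x ∈ G.faces | (y : Set W) ⊆ f '' (x : Set V)}

/-- The complex `H(G,f,P)`: the complete subgraphs of the inclusion graph on `pullbackSet G f P`. -/
def pullbackComplex : PreAbstractSimplicialComplex (Finset V) :=
  whitneyComplex (inclusionGraph V) (pullbackSet G f P)

/-- The complex of the patch `f⁻¹(y)`. -/
def patchComplex (y : Finset W) : PreAbstractSimplicialComplex (Finset V) :=
  whitneyComplex (inclusionGraph V) (patchSet G f y)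

end Pullback

end DiscreteManifold

/-! Both `U` and the patches consist of the simplices of `G` that meet every color of a finite set
`I`: for `U` the color of `v` is the part of `f v` and `I` is all `k + 1` parts; for a patch the
color is `f v` and `I = y`, again with `k + 1` elements. The unit sphere of `x` in such a set is the
join of the proper subsets of `x` that meet all colors with the simplices of `G` above `x`. The
upper factor is a `(d - |x|)`-sphere because `G` is a manifold. The lower factor has dimension `|x|
- |I| - 1`: it is a sphere if all colors of `x` lie in `I` (`isSphere_rainbowInterval`), and a ball
otherwise (`isBall_rainbowInterval`). The join has dimension `d - |I| = d - k - 1`. For `U` every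
color lies in `I`, so only spheres occur. The union statement holds because a complete subgraph of
the inclusion graph is a chain, and a facet covered by its smallest member is covered by all. -/

namespace DiscreteManifold

/-! ### Clique parity, collapses, and joins of spheres and balls. -/

section Join

variable {α : Type*} {Γ : SimpleGraph α}

/-- The number of complete subgraphs of the graph induced on `A`, including the empty one. -/
noncomputable def numCliques (Γ : SimpleGraph α) (A : Set α) : ℕ :=
  {c : Finset α | (c : Set α) ⊆ A ∧ Γ.IsClique (c : Set α)}.ncard

/-- Cliques either avoid `v` or contain it; erasing `v` from the latter gives the cliques of the
unit sphere. -/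
theorem numCliques_eq_add [Finite α] {A : Set α} {v : α} (hv : v ∈ A) :
    numCliques Γ A = numCliques Γ (A \ {v}) + numCliques Γ (unitSphere Γ A v) := by
  classical
  have hS : ∀ c : Finset α, (c : Set α) ⊆ unitSphere Γ A v → v ∉ c := fun c hc h =>
    Γ.irrefl (hc h).2
  have hinj : Set.InjOn (fun c : Finset α => insert v c)
      {c : Finset α | (c : Set α) ⊆ unitSphere Γ A v ∧ Γ.IsClique (c : Set α)} := by
    intro c hc e he h
    rw [← Finset.erase_insert (hS c hc.1), ← Finset.erase_insert (hS e he.1)]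
    exact congrArg (fun s => s.erase v) h
  unfold numCliques
  rw [← hinj.ncard_image, ← Set.ncard_union_eq]
  · congr 1
    ext c
    constructor
    · rintro ⟨hA, hc⟩
      by_cases hvc : v ∈ c
      · refine Or.inr ⟨c.erase v, ⟨?_, hc.subset (by simp)⟩, Finset.insert_erase hvc⟩
        intro u hu
        have hu' := Finset.mem_erase.1 (Finset.mem_coe.1 hu)
        exact ⟨hA hu'.2, hc hvc hu'.2 hu'.1.symm⟩
      · exact Or.inl ⟨fun u hu => ⟨hA hu, fun h => hvc (h ▸ hu)⟩, hc⟩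
    · rintro (⟨hA, hc⟩ | ⟨e, ⟨he, hc⟩, rfl⟩)
      · exact ⟨hA.trans Set.sdiff_subset, hc⟩
      · simp only [Set.mem_ofPred_eq, Finset.coe_insert, Set.insert_subset_iff]
        exact ⟨⟨hv, fun u hu => (he hu).1⟩, hc.insert fun u hu _ => (he hu).2⟩
  · rw [Set.disjoint_left]
    rintro c ⟨hA, -⟩ ⟨e, -, rfl⟩
    exact (hA (show v ∈ ((insert v e : Finset α) : Set α) by simp)).2 rfl

theorem numCliques_empty : numCliques Γ ∅ = 1 := by
  have : {c : Finset α | (c : Set α) ⊆ ∅ ∧ Γ.IsClique (c : Set α)} = {∅} := by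
    ext c
    simp only [Set.mem_ofPred_eq, Set.subset_empty_iff, Finset.coe_eq_empty,
      Set.mem_singleton_iff, and_iff_left_iff_imp]
    rintro rfl
    simp
  rw [numCliques, this, Set.ncard_singleton]

theorem unitSphere_singleton (v : α) : unitSphere Γ {v} v = ∅ := by
  ext u
  simp only [unitSphere, Set.mem_inter_iff, Set.mem_singleton_iff, SimpleGraph.mem_neighborSet,
    Set.mem_empty_iff_false, iff_false, not_and]
  rintro rfl
  exact Γ.irrefl

/-- The parity of the clique count separates contractible graphs (even) from spheres (odd). Since
boundary points are defined by not having a sphere as unit sphere, this is what identifies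
boundaries. -/
theorem IsContractible.even_numCliques [Finite α] {A : Set α} (h : IsContractible Γ A) :
    Even (numCliques Γ A) := by
  induction h with
  | point v =>
    rw [numCliques_eq_add (Set.mem_singleton v), unitSphere_singleton, Set.sdiff_self]
    exact ⟨_, rfl⟩
  | step A v hv _ _ h₁ h₂ =>
    rw [numCliques_eq_add hv]
    exact h₂.add h₁

theorem IsSphere.odd_numCliques [Finite α] {d : ℤ} {A : Set α} (h : IsSphere Γ d A) :
    Odd (numCliques Γ A) := by
  induction h with
  | empty => simp [numCliques_empty]
  | step d A hd _ hA ih =>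
    obtain ⟨v, hv, hc⟩ := hA
    rw [numCliques_eq_add hv]
    exact hc.even_numCliques.add_odd (ih v hv)

theorem IsSphere.unitSphere {d : ℤ} {A : Set α} (h : IsSphere Γ d A) {v : α} (hv : v ∈ A) :
    IsSphere Γ (d - 1) (unitSphere Γ A v) := by
  cases h with
  | empty => exact hv.elim
  | step _ _ _ hS _ => exact hS v hv

theorem IsBall.isContractible {d : ℤ} {A : Set α} (h : IsBall Γ d A) : IsContractible Γ A := by
  cases h
  assumption

theorem IsBall.not_isSphere [Finite α] {d e : ℤ} {A : Set α} (h : IsBall Γ d A) :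
    ¬ IsSphere Γ e A := fun hs =>
  (Nat.not_even_iff_odd.2 hs.odd_numCliques) h.isContractible.even_numCliques

/-- Remove the other vertices one by one: `c` remains an apex both of the unit sphere of the removed
vertex and of what is left. -/
theorem isContractible_of_apex [Finite α] {A : Set α} {c : α} (hc : c ∈ A)
    (h : ∀ u ∈ A, u ≠ c → Γ.Adj c u) : IsContractible Γ A := by
  induction hn : A.ncard using Nat.strong_induction_on generalizing A with
  | _ N ih =>
    by_cases hA : ∃ u ∈ A, u ≠ c
    · obtain ⟨u, hu, huc⟩ := hA
      have hlt : (A \ {u}).ncard < N := hn ▸ Set.ncard_sdiff_singleton_lt_of_mem hu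
      refine .step A u hu ?_ (ih _ hlt ⟨hc, huc.symm⟩ (fun w hw => h w hw.1) rfl)
      refine ih _ ((Set.ncard_le_ncard fun w hw => ?_).trans_lt hlt) ⟨hc, (h u hu huc).symm⟩
        (fun w hw => h w hw.1) rfl
      exact ⟨hw.1, fun e => Γ.irrefl (e ▸ hw.2)⟩
    · push Not at hA
      rw [Set.eq_singleton_iff_unique_mem.2 ⟨hc, hA⟩]
      exact .point c

/-- Removing the vertices of `T` one by one, in the order of increasing `ρ`, from a graph in which
their unit spheres are cones at the time of removal. -/
theorem isContractible_of_collapse [Finite α] (ρ : α → ℤ) {A T : Set α} (hTA : T ⊆ A)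
    (h : ∀ w ∈ T, ∃ c ∈ A \ T, Γ.Adj w c ∧
      ∀ u ∈ A, Γ.Adj w u → (u ∈ T → ρ w ≤ ρ u) → u ≠ c → Γ.Adj c u)
    (hc : IsContractible Γ (A \ T)) : IsContractible Γ A := by
  induction hn : T.ncard generalizing A T with
  | zero =>
    rw [Set.ncard_eq_zero] at hn
    simpa [hn] using hc
  | succ N ih =>
    obtain ⟨w, hw, hmin⟩ := T.exists_min_image ρ T.toFinite
      (Set.nonempty_of_ncard_ne_zero (by omega))
    obtain ⟨c, hcA, hwc, hcu⟩ := h w hw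
    refine .step A w (hTA hw) ?_ (ih (T := T \ {w}) (Set.sdiff_subset_sdiff_left hTA) ?_ ?_ ?_)
    · exact isContractible_of_apex ⟨hcA.1, hwc⟩ fun u hu => hcu u hu.1 hu.2 (hmin u)
    · intro w' hw'
      obtain ⟨c', hcA', hwc', hcu'⟩ := h w' hw'.1
      refine ⟨c', ⟨⟨hcA'.1, fun e => hcA'.2 (e ▸ hw)⟩, fun e => hcA'.2 e.1⟩, hwc', ?_⟩
      exact fun u hu hwu hρ => hcu' u hu.1 hwu fun huT => hρ ⟨huT, hu.2⟩
    · rwa [Set.sdiff_sdiff, Set.union_sdiff_cancel (Set.singleton_subset_iff.2 hw)]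
    · rw [Set.ncard_sdiff_singleton_of_mem hw]
      omega

theorem unitSphere_union_of_mem_left {A B : Set α} (h : ∀ a ∈ A, ∀ b ∈ B, Γ.Adj a b) {v : α}
    (hv : v ∈ A) : unitSphere Γ (A ∪ B) v = unitSphere Γ A v ∪ B := by
  ext u
  constructor
  · rintro ⟨hu | hu, huv⟩
    · exact Or.inl ⟨hu, huv⟩
    · exact Or.inr hu
  · rintro (⟨hu, huv⟩ | hu)
    · exact ⟨Or.inl hu, huv⟩
    · exact ⟨Or.inr hu, h v hv u hu⟩

theorem unitSphere_union_of_mem_right {A B : Set α} (h : ∀ a ∈ A, ∀ b ∈ B, Γ.Adj a b) {v : α}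
    (hv : v ∈ B) : unitSphere Γ (A ∪ B) v = A ∪ unitSphere Γ B v := by
  rw [Set.union_comm, unitSphere_union_of_mem_left (fun b hb a ha => (h a ha b hb).symm) hv,
    Set.union_comm]

theorem union_diff_singleton_of_mem_left {A B : Set α} (h : ∀ a ∈ A, ∀ b ∈ B, Γ.Adj a b) {v : α}
    (hv : v ∈ A) : (A ∪ B) \ {v} = A \ {v} ∪ B := by
  rw [Set.union_sdiff_distrib, Set.sdiff_singleton_eq_self (s := B)]
  exact fun hvB => Γ.irrefl (h v hv v hvB)

theorem IsContractible.union [Finite α] {A B : Set α} (hA : IsContractible Γ A)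
    (h : ∀ a ∈ A, ∀ b ∈ B, Γ.Adj a b) : IsContractible Γ (A ∪ B) := by
  induction hA with
  | point v =>
    refine isContractible_of_apex (Or.inl rfl) ?_
    rintro u (hu | hu) huv
    · exact (huv hu).elim
    · exact h v rfl u hu
  | step A v hv _ _ h₁ h₂ =>
    refine .step _ v (Or.inl hv) ?_ ?_
    · rw [unitSphere_union_of_mem_left h hv]
      exact h₁ fun a ha => h a ha.1
    · rw [union_diff_singleton_of_mem_left h hv]
      exact h₂ fun a ha => h a ha.1

theorem IsSphere.neg_one_le {d : ℤ} {A : Set α} (h : IsSphere Γ d A) : -1 ≤ d := by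
  cases h <;> omega

/-- The unit sphere of a vertex in a join is the join of its unit sphere in one factor with the
other factor, so a double induction applies; puncturing `A` leaves a join with a contractible
factor. -/
theorem IsSphere.union [Finite α] {a b : ℤ} {A B : Set α} (hA : IsSphere Γ a A)
    (hB : IsSphere Γ b B) (h : ∀ a ∈ A, ∀ b ∈ B, Γ.Adj a b) :
    IsSphere Γ (a + b + 1) (A ∪ B) := by
  induction hA generalizing b B with
  | empty => simpa using hB
  | step a A ha hS hA ihA =>
    induction hB with
    | empty => simpa using IsSphere.step a A ha hS hA
    | step b B hb hSB hB ihB =>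
      refine .step _ _ (by omega) ?_ ?_
      · rintro v (hv | hv)
        · rw [unitSphere_union_of_mem_left h hv,
            show a + b + 1 - 1 = a - 1 + b + 1 by ring]
          exact ihA v hv (.step b B hb hSB hB) fun u hu => h u hu.1
        · rw [unitSphere_union_of_mem_right h hv,
            show a + b + 1 - 1 = a + (b - 1) + 1 by ring]
          exact ihB v hv fun u hu w hw => h u hu w hw.1
      · obtain ⟨v, hv, hc⟩ := hA
        refine ⟨v, Or.inl hv, ?_⟩
        rw [union_diff_singleton_of_mem_left h hv]
        exact hc.union fun u hu => h u hu.1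

/-- A contractible graph is a `d`-ball if its unit spheres are balls on a set `D` that is
a `(d-1)`-sphere, and spheres elsewhere. -/
theorem IsBall.of_boundary [Finite α] {d : ℤ} {A D : Set α} (hc : IsContractible Γ A)
    (hDA : D ⊆ A) (hD : IsSphere Γ (d - 1) D)
    (hball : ∀ v ∈ D, IsBall Γ (d - 1) (DiscreteManifold.unitSphere Γ A v))
    (hsphere : ∀ v ∈ A, v ∉ D → IsSphere Γ (d - 1) (DiscreteManifold.unitSphere Γ A v)) :
    IsBall Γ d A := by
  have hb : boundary Γ d A = D := by
    ext v
    constructor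
    · rintro ⟨hv, hn⟩
      by_contra hvD
      exact hn (hsphere v hv hvD)
    · exact fun hv => ⟨hDA hv, (hball v hv).not_isSphere⟩
  have := hD.neg_one_le
  exact .mk d A (by omega) hc (hb ▸ hball) (hb ▸ hD)

/-- The boundary of the join is the join of the boundary of `A` with all of `B`. -/
theorem IsBall.union [Finite α] {a b : ℤ} {A B : Set α} (hA : IsBall Γ a A)
    (hB : IsSphere Γ b B) (h : ∀ a ∈ A, ∀ b ∈ B, Γ.Adj a b) :
    IsBall Γ (a + b + 1) (A ∪ B) := by
  induction hA generalizing b B with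
  | mk a A ha hcA hSA hbA ihA =>
    have hA := IsBall.mk a A ha hcA hSA hbA
    have hint : ∀ v ∈ A, v ∉ boundary Γ a A → IsSphere Γ (a - 1)
        (DiscreteManifold.unitSphere Γ A v) := fun v hv hvb => by
      by_contra hn
      exact hvb ⟨hv, hn⟩
    induction hB with
    | empty => simpa using hA
    | step b B hb hSB hB ihB =>
      have hB' := IsSphere.step b B hb hSB hB
      refine .of_boundary (D := boundary Γ a A ∪ B) (hcA.union h)
        (Set.union_subset_union_left _ fun v hv => hv.1) ?_ ?_ ?_
      · rw [show a + b + 1 - 1 = a - 1 + b + 1 by ring]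
        exact hbA.union hB' fun u hu => h u hu.1
      · rintro v (hv | hv)
        · rw [unitSphere_union_of_mem_left h hv.1, show a + b + 1 - 1 = a - 1 + b + 1 by ring]
          exact ihA v hv hB' fun u hu => h u hu.1
        · rw [unitSphere_union_of_mem_right h hv, show a + b + 1 - 1 = a + (b - 1) + 1 by ring]
          exact ihB v hv fun u hu w hw => h u hu w hw.1
      · rintro v (hv | hv) hvD
        · rw [unitSphere_union_of_mem_left h hv, show a + b + 1 - 1 = a - 1 + b + 1 by ring]
          exact (hint v hv fun hvb => hvD (Or.inl hvb)).union hB' fun u hu => h u hu.1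
        · exact (hvD (Or.inr hv)).elim

end Join

/-! ### Intervals of sets meeting prescribed colors. -/

section Rainbow

variable {V : Type*}

theorem inclusionGraph_adj {x y : Finset V} : (inclusionGraph V).Adj x y ↔ x ⊂ y ∨ y ⊂ x := by
  rw [inclusionGraph, SimpleGraph.fromRel_adj, Finset.ssubset_iff_subset_ne,
    Finset.ssubset_iff_subset_ne]
  tauto

/-- The sets `w` with `a ⊆ w ⊂ x` such that `w \ a` contains points of all colors in `I`. -/
def rainbowInterval {ι : Type*} (g : V → ι) (I : Finset ι) (a x : Finset V) :
    Set (Finset V) :=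
  {w | a ⊆ w ∧ w ⊂ x ∧ ∀ i ∈ I, ∃ p ∈ w, p ∉ a ∧ g p = i}

/-- The sets strictly between `a` and `x`, as the sets `w` such that `w \ a` is non-empty. -/
theorem mem_rainbowInterval_unit {a x w : Finset V} :
    w ∈ rainbowInterval (fun _ => ()) {()} a x ↔ a ⊂ w ∧ w ⊂ x := by
  constructor
  · rintro ⟨haw, hwx, h⟩
    obtain ⟨p, hp, hpa, -⟩ := h () (Finset.mem_singleton_self ())
    exact ⟨⟨haw, fun hwa => hpa (hwa hp)⟩, hwx⟩
  · rintro ⟨haw, hwx⟩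
    obtain ⟨p, hp, hpa⟩ := Finset.exists_of_ssubset haw
    exact ⟨haw.1, hwx, fun _ _ => ⟨p, hp, hpa, rfl⟩⟩

theorem rainbowInterval_adj {ι : Type*} {g : V → ι} {I : Finset ι} {a z : Finset V}
    {S : Set (Finset V)} (hS : ∀ u ∈ S, z ⊂ u) :
    ∀ w ∈ rainbowInterval g I a z, ∀ u ∈ S, (inclusionGraph V).Adj w u :=
  fun _ hw u hu => inclusionGraph_adj.2 (Or.inl (hw.2.1.trans (hS u hu)))

/-- A set above `z` inherits the colors of `z`, so the upper part is the full open interval between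
`z` and `x`, which is itself a rainbow interval with one color. -/
theorem unitSphere_rainbowInterval {ι : Type*} {g : V → ι} {I : Finset ι} {a x z : Finset V}
    (hz : z ∈ rainbowInterval g I a x) :
    unitSphere (inclusionGraph V) (rainbowInterval g I a x) z =
      rainbowInterval g I a z ∪ rainbowInterval (fun _ => ()) {()} z x := by
  ext w
  obtain ⟨haz, hzx, hzI⟩ := hz
  constructor
  · rintro ⟨⟨haw, hwx, hwI⟩, h⟩
    rcases inclusionGraph_adj.1 h with h | h
    · exact Or.inr (mem_rainbowInterval_unit.2 ⟨h, hwx⟩)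
    · exact Or.inl ⟨haw, h, hwI⟩
  · rintro (⟨haw, hwz, hwI⟩ | h)
    · exact ⟨⟨haw, hwz.trans hzx, hwI⟩, inclusionGraph_adj.2 (Or.inr hwz)⟩
    · obtain ⟨hzw, hwx⟩ := mem_rainbowInterval_unit.1 h
      refine ⟨⟨haz.trans hzw.1, hwx, fun i hi => ?_⟩, inclusionGraph_adj.2 (Or.inl hzw)⟩
      obtain ⟨p, hp, hpa⟩ := hzI i hi
      exact ⟨p, hzw.1 hp, hpa⟩

/-- A point `p` of superfluous color can be erased from any `w` without losing a required color.
Collapsing the sets that contain `p`, smallest first, leaves a cone with apex `x.erase p`. -/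
theorem isContractible_rainbowInterval [Finite V] {ι : Type*} {g : V → ι} {I : Finset ι}
    {a x : Finset V} (hax : a ⊆ x) (hI : ∀ i ∈ I, ∃ p ∈ x, p ∉ a ∧ g p = i)
    (hr : ∃ p ∈ x, p ∉ a ∧ g p ∉ I) :
    IsContractible (inclusionGraph V) (rainbowInterval g I a x) := by
  classical
  obtain ⟨p, hpx, hpa, hpI⟩ := hr
  have herase : ∀ w : Finset V, a ⊆ w → (∀ i ∈ I, ∃ p ∈ w, p ∉ a ∧ g p = i) →
      a ⊆ w.erase p ∧ ∀ i ∈ I, ∃ q ∈ w.erase p, q ∉ a ∧ g q = i := by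
    intro w haw hwI
    refine ⟨Finset.subset_erase.2 ⟨haw, hpa⟩, fun i hi => ?_⟩
    obtain ⟨q, hq, hqa, rfl⟩ := hwI i hi
    exact ⟨q, Finset.mem_erase.2 ⟨fun e => hpI (e ▸ hi), hq⟩, hqa, rfl⟩
  refine isContractible_of_collapse (fun w => (w.card : ℤ))
    (T := {w | w ∈ rainbowInterval g I a x ∧ p ∈ w}) (fun w hw => hw.1) ?_ ?_
  · rintro w ⟨⟨haw, hwx, hwI⟩, hpw⟩
    obtain ⟨h₁, h₂⟩ := herase w haw hwI
    refine ⟨w.erase p, ⟨⟨h₁, (Finset.erase_subset _ _).trans_ssubset hwx, h₂⟩, fun h => by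
      simp at h⟩, inclusionGraph_adj.2 (Or.inr (Finset.erase_ssubset hpw)), ?_⟩
    intro u hu hwu hρ hne
    rcases inclusionGraph_adj.1 hwu with hwu | huw
    · exact inclusionGraph_adj.2 (Or.inl ((Finset.erase_ssubset hpw).trans hwu))
    · have hpu : p ∉ u := fun hpu => by
        have h₁ := hρ ⟨hu, hpu⟩
        have h₂ := Finset.card_lt_card huw
        omega
      exact inclusionGraph_adj.2
        (Or.inr ((Finset.subset_erase.2 ⟨huw.1, hpu⟩).ssubset_of_ne hne))
  · obtain ⟨h₁, h₂⟩ := herase x hax hI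
    refine isContractible_of_apex (c := x.erase p)
      ⟨⟨h₁, Finset.erase_ssubset hpx, h₂⟩, fun h => by simp at h⟩ ?_
    rintro u ⟨hu, huT⟩ hne
    have hpu : p ∉ u := fun hpu => huT ⟨hu, hpu⟩
    exact inclusionGraph_adj.2
      (Or.inr ((Finset.subset_erase.2 ⟨hu.2.1.1, hpu⟩).ssubset_of_ne hne))

theorem card_sdiff_eq_add [DecidableEq V] {a z x : Finset V} (haz : a ⊆ z) (hzx : z ⊆ x) :
    (x \ a).card = (z \ a).card + (x \ z).card := by
  have h₁ := Finset.card_sdiff_add_card_eq_card haz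
  have h₂ := Finset.card_sdiff_add_card_eq_card hzx
  have h₃ := Finset.card_sdiff_add_card_eq_card (haz.trans hzx)
  omega

/-- Dually, a set avoiding `p` is pushed up to `insert p w`, largest first; this is a proper subset
of `x` because `x.erase p` was removed. What remains is an interval above `insert p a` in which the
color of `p` is no longer required, so `q` is superfluous there. -/
theorem isContractible_rainbowInterval_diff_singleton [Finite V] {ι : Type*} {g : V → ι}
    {I : Finset ι} {a x : Finset V} [DecidableEq V] (hax : a ⊆ x)
    (hI : ∀ i ∈ I, ∃ p ∈ x, p ∉ a ∧ g p = i) {p q : V} (hp : p ∈ x) (hpa : p ∉ a)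
    (hq : q ∈ x) (hqa : q ∉ a) (hpq : p ≠ q) (hg : g p = g q) :
    IsContractible (inclusionGraph V) (rainbowInterval g I a x \ {x.erase p}) := by
  classical
  refine isContractible_of_collapse (fun w => -(w.card : ℤ))
    (T := {w | w ∈ rainbowInterval g I a x ∧ w ≠ x.erase p ∧ p ∉ w}) (fun w hw => ⟨hw.1, hw.2.1⟩)
    ?_ ?_
  · rintro w ⟨⟨haw, hwx, hwI⟩, hne, hpw⟩
    have hins : insert p w ⊂ x := by
      refine (Finset.insert_subset hp hwx.1).ssubset_of_ne fun e => hne ?_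
      rw [← e, Finset.erase_insert hpw]
    refine ⟨insert p w, ⟨⟨⟨haw.trans (Finset.subset_insert _ _), hins, fun i hi => ?_⟩,
      fun h => ?_⟩, fun h => h.2.2 (Finset.mem_insert_self _ _)⟩,
      inclusionGraph_adj.2 (Or.inl (Finset.ssubset_insert hpw)), ?_⟩
    · obtain ⟨s, hs, hsa⟩ := hwI i hi
      exact ⟨s, Finset.mem_insert_of_mem hs, hsa⟩
    · have : p ∈ x.erase p := h ▸ Finset.mem_insert_self p w
      simp at this
    · intro u hu hwu hρ hne
      rcases inclusionGraph_adj.1 hwu with hwu | huw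
      · have hpu : p ∈ u := by
          by_contra hpu
          have h₁ := hρ ⟨hu.1, hu.2, hpu⟩
          have h₂ := Finset.card_lt_card hwu
          omega
        exact inclusionGraph_adj.2
          (Or.inl ((Finset.insert_subset hpu hwu.1).ssubset_of_ne hne.symm))
      · exact inclusionGraph_adj.2 (Or.inr (huw.trans (Finset.ssubset_insert hpw)))
  · have heq : (rainbowInterval g I a x \ {x.erase p}) \
        {w | w ∈ rainbowInterval g I a x ∧ w ≠ x.erase p ∧ p ∉ w} =
        rainbowInterval g (I.erase (g p)) (insert p a) x := by
      ext w
      constructor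
      · rintro ⟨⟨hw, hne⟩, hT⟩
        have hpw : p ∈ w := by
          by_contra hpw
          exact hT ⟨hw, hne, hpw⟩
        refine ⟨Finset.insert_subset hpw hw.1, hw.2.1, fun i hi => ?_⟩
        obtain ⟨s, hs, hsa, rfl⟩ := hw.2.2 i (Finset.mem_of_mem_erase hi)
        refine ⟨s, hs, fun h => ?_, rfl⟩
        rcases Finset.mem_insert.1 h with rfl | h
        · simp at hi
        · exact hsa h
      · rintro ⟨hiw, hwx, hwI⟩
        have hpw : p ∈ w := hiw (Finset.mem_insert_self _ _)
        refine ⟨⟨⟨(Finset.subset_insert _ _).trans hiw, hwx, fun i hi => ?_⟩, ?_⟩, fun h =>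
          h.2.2 hpw⟩
        · by_cases hip : i = g p
          · exact ⟨p, hpw, hpa, hip.symm⟩
          · obtain ⟨s, hs, hsa, hsi⟩ := hwI i (Finset.mem_erase.2 ⟨hip, hi⟩)
            exact ⟨s, hs, fun h => hsa (Finset.mem_insert_of_mem h), hsi⟩
        · rintro rfl
          simp at hpw
    rw [heq]
    refine isContractible_rainbowInterval (Finset.insert_subset hp hax) (fun i hi => ?_)
      ⟨q, hq, by simp [hpq.symm, hqa], by simp [hg]⟩
    obtain ⟨s, hs, hsa, rfl⟩ := hI i (Finset.mem_of_mem_erase hi)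
    refine ⟨s, hs, fun h => ?_, rfl⟩
    rcases Finset.mem_insert.1 h with rfl | h
    · simp at hi
    · exact hsa h

theorem card_le_card_sdiff {ι : Type*} {g : V → ι} {I : Finset ι} {a x : Finset V}
    [DecidableEq V] (hI : ∀ i ∈ I, ∃ p ∈ x, p ∉ a ∧ g p = i) : I.card ≤ (x \ a).card := by
  classical
  refine (Finset.card_le_card fun i hi => ?_).trans (Finset.card_image_le (f := g))
  obtain ⟨p, hp, hpa, hpi⟩ := hI i hi
  exact Finset.mem_image.2 ⟨p, Finset.mem_sdiff.2 ⟨hp, hpa⟩, hpi⟩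

theorem rainbowInterval_eq_empty [DecidableEq V] {ι : Type*} {g : V → ι} {I : Finset ι}
    {a x : Finset V} (h : (x \ a).card = I.card) : rainbowInterval g I a x = ∅ := by
  refine Set.eq_empty_of_forall_notMem fun w hw => ?_
  have h₁ := card_le_card_sdiff hw.2.2
  have h₂ := card_sdiff_eq_add hw.1 hw.2.1.1
  have h₃ := Finset.card_pos.2 (Finset.sdiff_nonempty.2 hw.2.1.2)
  omega

theorem exists_mem_notMem_of_ssubset {a x : Finset V} (h : a ⊂ x) :
    ∀ i ∈ ({()} : Finset Unit), ∃ p ∈ x, p ∉ a ∧ () = i := fun _ _ =>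
  let ⟨p, hp, hpa⟩ := Finset.exists_of_ssubset h
  ⟨p, hp, hpa, rfl⟩

/-- With as many points as colors no proper subset qualifies, which gives the empty sphere.
Otherwise two points share a color, and removing the vertex `x.erase p` leaves a contractible graph.
The color type varies in the induction because the upper factor of a unit sphere uses `Unit`. -/
theorem isSphere_rainbowInterval [Finite V] [DecidableEq V] {ι : Type} {g : V → ι}
    {I : Finset ι} {a x : Finset V} (hax : a ⊆ x) (hI : ∀ i ∈ I, ∃ p ∈ x, p ∉ a ∧ g p = i)
    (hg : ∀ p ∈ x, p ∉ a → g p ∈ I) :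
    IsSphere (inclusionGraph V) ((x \ a).card - I.card - 1) (rainbowInterval g I a x) := by
  induction hm : (x \ a).card using Nat.strong_induction_on generalizing ι g I a x with
  | _ m ih =>
    have hle := card_le_card_sdiff hI
    rcases hle.eq_or_lt with heq | hlt
    · rw [rainbowInterval_eq_empty heq.symm, heq, hm, sub_self, zero_sub]
      exact .empty
    · refine .step _ _ (by omega) (fun z hz => ?_) ?_
      · have haz : a ⊂ z := by
          refine hz.1.ssubset_of_ne ?_
          rintro rfl
          obtain ⟨p, hp, hpa⟩ := Finset.exists_of_ssubset hz.2.1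
          obtain ⟨q, hq, hqa, -⟩ := hz.2.2 _ (hg p hp hpa)
          exact hqa hq
        have hcard := card_sdiff_eq_add hz.1 hz.2.1.1
        have h₁ := Finset.card_pos.2 (Finset.sdiff_nonempty.2 hz.2.1.2)
        have h₂ := Finset.card_pos.2 (Finset.sdiff_nonempty.2 haz.2)
        rw [unitSphere_rainbowInterval hz]
        have hl := ih (z \ a).card (by omega) hz.1 hz.2.2
          (fun p hp => hg p (hz.2.1.1 hp)) rfl
        have hu := ih (x \ z).card (by omega) hz.2.1.1 (exists_mem_notMem_of_ssubset hz.2.1)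
          (fun _ _ _ => Finset.mem_singleton_self ()) rfl
        convert hl.union hu (rainbowInterval_adj fun u hu => (mem_rainbowInterval_unit.1 hu).1)
          using 1
        rw [← hm, hcard, Finset.card_singleton]
        push_cast
        ring
      · obtain ⟨p, hp, q, hq, hpq, hgpq⟩ := Finset.exists_ne_map_eq_of_card_lt_of_maps_to hlt
          (f := g) fun p hp => hg p (Finset.mem_sdiff.1 hp).1 (Finset.mem_sdiff.1 hp).2
        rw [Finset.mem_sdiff] at hp hq
        refine ⟨x.erase p, ⟨Finset.subset_erase.2 ⟨hax, hp.2⟩, Finset.erase_ssubset hp.1,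
          fun i hi => ?_⟩, isContractible_rainbowInterval_diff_singleton hax hI hp.1 hp.2 hq.1
            hq.2 hpq hgpq⟩
        obtain ⟨s, hs, hsa, rfl⟩ := hI i hi
        by_cases hsp : s = p
        · exact ⟨q, Finset.mem_erase.2 ⟨hpq.symm, hq.1⟩, hq.2, by rw [hsp, hgpq]⟩
        · exact ⟨s, Finset.mem_erase.2 ⟨hsp, hs⟩, hsa, rfl⟩

theorem isSphere_rainbowInterval_unit [Finite V] [DecidableEq V] {a x : Finset V} (h : a ⊂ x) :
    IsSphere (inclusionGraph V) ((x \ a).card - 2)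
      (rainbowInterval (fun _ => ()) {()} a x) := by
  convert isSphere_rainbowInterval h.1 (exists_mem_notMem_of_ssubset h)
    (fun _ _ _ => Finset.mem_singleton_self ()) using 1
  rw [Finset.card_singleton]
  push_cast
  ring

/-- The points of a color outside `I` are given a single additional color. -/
theorem exists_rainbowInterval_eq {ι : Type} (g : V → ι) (I : Finset ι) :
    ∃ (h : V → Option ι) (J : Finset (Option ι)), J.card = I.card + 1 ∧ (∀ p, h p ∈ J) ∧
      ∀ a w : Finset V, (∀ i ∈ J, ∃ p ∈ w, p ∉ a ∧ h p = i) ↔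
        (∀ i ∈ I, ∃ p ∈ w, p ∉ a ∧ g p = i) ∧ ∃ p ∈ w, p ∉ a ∧ g p ∉ I := by
  classical
  refine ⟨fun p => if g p ∈ I then some (g p) else none, Finset.insertNone I,
    Finset.card_insertNone I, fun p => ?_, fun a w => ?_⟩
  · by_cases hp : g p ∈ I <;> simp [hp]
  · rw [Finset.forall_mem_insertNone, and_comm]
    refine and_congr (forall₂_congr fun i hi => exists_congr fun p => ?_)
      (exists_congr fun p => ?_)
    · by_cases hp : g p ∈ I
      · simp [hp]
      · have : g p ≠ i := fun e => hp (e ▸ hi)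
        simp [hp, this]
    · by_cases hp : g p ∈ I <;> simp [hp]

/-- The boundary consists of the sets that also contain a superfluous point outside `a`. Giving such
points one extra color makes it a rainbow interval with all colors required, a sphere of one
dimension less. -/
theorem isBall_rainbowInterval [Finite V] [DecidableEq V] {ι : Type} {g : V → ι}
    {I : Finset ι} {a x : Finset V} (hax : a ⊆ x) (hI : ∀ i ∈ I, ∃ p ∈ x, p ∉ a ∧ g p = i)
    (hg : ∃ p ∈ x, p ∉ a ∧ g p ∉ I) :
    IsBall (inclusionGraph V) ((x \ a).card - I.card - 1) (rainbowInterval g I a x) := by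
  induction hm : (x \ a).card using Nat.strong_induction_on generalizing x with
  | _ m ih =>
    obtain ⟨h, J, hJ, hhJ, hiff⟩ := exists_rainbowInterval_eq g I
    have hdim : ∀ z ∈ rainbowInterval g I a x, (m : ℤ) - I.card - 1 - 1 =
        ((z \ a).card - I.card - 1) + ((x \ z).card - 2) + 1 := fun z hz => by
      rw [← hm, card_sdiff_eq_add hz.1 hz.2.1.1]
      push_cast
      ring
    refine .of_boundary (D := rainbowInterval h J a x)
      (isContractible_rainbowInterval hax hI hg)
      (fun w hw => ⟨hw.1, hw.2.1, ((hiff a w).1 hw.2.2).1⟩) ?_ (fun z hz => ?_)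
      (fun z hz hzD => ?_)
    · convert isSphere_rainbowInterval hax ((hiff a x).2 ⟨hI, hg⟩) (fun p _ _ => hhJ p) using 1
      rw [hJ, hm]
      push_cast
      ring
    · obtain ⟨hzI, hzr⟩ := (hiff a z).1 hz.2.2
      have hz' : z ∈ rainbowInterval g I a x := ⟨hz.1, hz.2.1, hzI⟩
      have hcard := card_sdiff_eq_add hz.1 hz.2.1.1
      have hpos := Finset.card_pos.2 (Finset.sdiff_nonempty.2 hz.2.1.2)
      rw [unitSphere_rainbowInterval hz', hdim z hz']
      exact (ih _ (by omega) hz.1 hzI hzr rfl).union (isSphere_rainbowInterval_unit hz.2.1)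
        (rainbowInterval_adj fun u hu => (mem_rainbowInterval_unit.1 hu).1)
    · rw [unitSphere_rainbowInterval hz, hdim z hz]
      refine (isSphere_rainbowInterval hz.1 hz.2.2 fun p hp hpa => ?_).union
        (isSphere_rainbowInterval_unit hz.2.1)
        (rainbowInterval_adj fun u hu => (mem_rainbowInterval_unit.1 hu).1)
      by_contra hpI
      exact hzD ⟨hz.1, hz.2.1, (hiff a z).2 ⟨hz.2.2, p, hp, hpa, hpI⟩⟩

end Rainbow

/-! ### Unit spheres of rainbow sets in a manifold complex. -/

section Manifold

variable {V : Type*}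

/-- In a complex that is a `d`-manifold, the simplices strictly containing a simplex `x`
form a `(d - |x|)`-sphere. -/
theorem IsManifoldComplex.isSphere_ssuperset {d : ℤ} {G : AbstractSimplicialComplex V}
    (hG : IsManifoldComplex d G) {x : Finset V} (hx : x ∈ G.faces) :
    IsSphere (inclusionGraph V) (d - x.card) {w ∈ G.faces | x ⊂ w} := by
  classical
  -- Start with the unit sphere of `x` and descend along a flag of faces `z` of `x`, each time
  -- taking the unit sphere of `z` in the previous sphere. At a single vertex nothing is left below
  -- `z`.
  have key : ∀ (m : ℕ) (z : Finset V), z.Nonempty → z ⊆ x → z.card + m = x.card →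
      IsSphere (inclusionGraph V) (d - 1 - m) {w ∈ G.faces | w ⊂ z ∨ x ⊂ w} := by
    intro m
    induction m with
    | zero =>
      intro z _ hzx hm
      obtain rfl := Finset.eq_of_subset_of_card_le hzx (by omega)
      convert hG z hx using 1
      · simp
      · ext w
        exact and_congr_right fun _ => by
          rw [SimpleGraph.mem_neighborSet, inclusionGraph_adj, or_comm]
    | succ m ih =>
      intro z hz hzx hm
      obtain ⟨p, hpx, hpz⟩ := Finset.exists_mem_notMem_of_card_lt_card
        (show z.card < x.card by omega)
      have h := ih (insert p z) (Finset.insert_nonempty p z) (Finset.insert_subset hpx hzx)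
        (by rw [Finset.card_insert_of_notMem hpz]; omega)
      have hzG : z ∈ G.faces := (G.isRelLowerSet_faces hx).2 hzx hz
      convert h.unitSphere ⟨hzG, Or.inl (Finset.ssubset_insert hpz)⟩ using 1
      · push_cast
        ring
      · ext w
        simp only [unitSphere, Set.mem_inter_iff, Set.mem_ofPred_eq, SimpleGraph.mem_neighborSet,
          inclusionGraph_adj, and_assoc]
        refine and_congr_right fun _ => ⟨?_, ?_⟩
        · rintro (h | h)
          · exact ⟨Or.inl (h.trans (Finset.ssubset_insert hpz)), Or.inr h⟩
          · exact ⟨Or.inr h, Or.inl (hzx.trans_ssubset h)⟩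
        · rintro ⟨h | h, h' | h'⟩
          · have h₁ := Finset.card_lt_card h
            have h₂ := Finset.card_lt_card h'
            rw [Finset.card_insert_of_notMem hpz] at h₁
            omega
          all_goals simp [h, h']
  obtain ⟨p, hp⟩ := (G.isRelLowerSet_faces hx).1
  have hpos := Finset.card_pos.2 ⟨p, hp⟩
  convert key (x.card - 1) {p} (Finset.singleton_nonempty p) (Finset.singleton_subset_iff.2 hp)
    (by rw [Finset.card_singleton]; omega) using 1
  · push_cast [Nat.cast_sub hpos]
    ring
  · ext w
    refine and_congr_right fun hw => ?_
    rw [Finset.ssubset_singleton_iff, or_iff_right (G.isRelLowerSet_faces hw).1.ne_empty]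

/-- The simplices of `G` that contain vertices of all colors in `I`. -/
def rainbowSet {ι : Type*} (G : AbstractSimplicialComplex V) (g : V → ι) (I : Finset ι) :
    Set (Finset V) :=
  {x ∈ G.faces | ∀ i ∈ I, ∃ p ∈ x, g p = i}

/-- Nonemptiness of `I` keeps the empty set, which is not a simplex, out of the lower factor. -/
theorem unitSphere_rainbowSet {ι : Type*} {G : AbstractSimplicialComplex V} {g : V → ι}
    {I : Finset ι} (hI : I.Nonempty) {x : Finset V} (hx : x ∈ rainbowSet G g I) :
    unitSphere (inclusionGraph V) (rainbowSet G g I) x =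
      rainbowInterval g I ∅ x ∪ {w ∈ G.faces | x ⊂ w} := by
  ext w
  constructor
  · rintro ⟨hw, h⟩
    rcases inclusionGraph_adj.1 h with h | h
    · exact Or.inr ⟨hw.1, h⟩
    · exact Or.inl ⟨Finset.empty_subset w, h, by simpa using hw.2⟩
  · rintro (⟨-, hwx, hwI⟩ | ⟨hw, hxw⟩)
    · obtain ⟨i, hi⟩ := hI
      obtain ⟨p, hp, -⟩ := hwI i hi
      exact ⟨⟨(G.isRelLowerSet_faces hx.1).2 hwx.1 ⟨p, hp⟩, by simpa using hwI⟩,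
        inclusionGraph_adj.2 (Or.inr hwx)⟩
    · refine ⟨⟨hw, fun i hi => ?_⟩, inclusionGraph_adj.2 (Or.inl hxw)⟩
      obtain ⟨p, hp, hpi⟩ := hx.2 i hi
      exact ⟨p, hxw.1 hp, hpi⟩

theorem isSphere_unitSphere_rainbowSet [Finite V] {ι : Type} {d : ℤ}
    {G : AbstractSimplicialComplex V} (hG : IsManifoldComplex d G) {g : V → ι} {I : Finset ι}
    (hI : I.Nonempty) {x : Finset V} (hx : x ∈ rainbowSet G g I) (hg : ∀ p ∈ x, g p ∈ I) :
    IsSphere (inclusionGraph V) (d - I.card)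
      (unitSphere (inclusionGraph V) (rainbowSet G g I) x) := by
  classical
  rw [unitSphere_rainbowSet hI hx]
  convert (isSphere_rainbowInterval (Finset.empty_subset x) (by simpa using hx.2)
    (fun p hp _ => hg p hp)).union (hG.isSphere_ssuperset hx.1)
    (rainbowInterval_adj fun u hu => hu.2) using 1
  rw [Finset.sdiff_empty]
  ring

theorem isBall_unitSphere_rainbowSet [Finite V] {ι : Type} {d : ℤ}
    {G : AbstractSimplicialComplex V} (hG : IsManifoldComplex d G) {g : V → ι} {I : Finset ι}
    (hI : I.Nonempty) {x : Finset V} (hx : x ∈ rainbowSet G g I) (hg : ∃ p ∈ x, g p ∉ I) :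
    IsBall (inclusionGraph V) (d - I.card)
      (unitSphere (inclusionGraph V) (rainbowSet G g I) x) := by
  classical
  rw [unitSphere_rainbowSet hI hx]
  convert (isBall_rainbowInterval (Finset.empty_subset x) (by simpa using hx.2)
    (by simpa using hg)).union (hG.isSphere_ssuperset hx.1)
    (rainbowInterval_adj fun u hu => hu.2) using 1
  rw [Finset.sdiff_empty]
  ring

theorem patchSet_eq_rainbowSet {W : Type*} (G : AbstractSimplicialComplex V) (f : V → W)
    (y : Finset W) : patchSet G f y = rainbowSet G f y := rfl

end Manifold

/-! ### Facets of the partition complex and the pullback as a rainbow set. -/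

section Partition

variable {k : ℕ} {n : Fin (k + 1) → ℕ}

theorem mem_partitionComplex {y : Finset (Σ j, Fin (n j))} :
    y ∈ (partitionComplex n).faces ↔
      y.Nonempty ∧ ∀ p ∈ y, ∀ q ∈ y, p ≠ q → p.1 ≠ q.1 := by
  constructor
  · rintro ⟨hy, -, h⟩
    exact ⟨hy, fun p hp q hq hpq => h hp hq hpq⟩
  · rintro ⟨hy, h⟩
    exact ⟨hy, Set.subset_univ _, fun p hp q hq hpq => h p hp q hq hpq⟩

theorem isFacet_partitionComplex_iff (hn : ∀ j, 0 < n j) {y : Finset (Σ j, Fin (n j))} :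
    IsFacet (partitionComplex n) y ↔
      y ∈ (partitionComplex n).faces ∧ ∀ j, ∃ p ∈ y, p.1 = j := by
  classical
  constructor
  · refine fun hy => ⟨hy.1, fun j => ?_⟩
    by_contra! hj
    have hy' := (mem_partitionComplex.1 hy.1).2
    have hmem : insert ⟨j, ⟨0, hn j⟩⟩ y ∈ (partitionComplex n).faces := by
      refine mem_partitionComplex.2 ⟨Finset.insert_nonempty _ _, fun p hp q hq hpq => ?_⟩
      rcases Finset.mem_insert.1 hp with rfl | hp <;> rcases Finset.mem_insert.1 hq with rfl | hq
      · exact (hpq rfl).elim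
      · exact (hj q hq).symm
      · exact hj p hp
      · exact hy' p hp q hq hpq
    exact hj _ (hy.2 hmem (Finset.subset_insert _ _) (Finset.mem_insert_self _ _)) rfl
  · rintro ⟨hy, hall⟩
    refine ⟨hy, fun z hz hyz q hq => ?_⟩
    obtain ⟨p, hp, hpq⟩ := hall q.1
    by_cases h : p = q
    · exact h ▸ hp
    · exact ((mem_partitionComplex.1 hz).2 p (hyz hp) q hq h hpq).elim

theorem card_of_isFacet (hn : ∀ j, 0 < n j) {y : Finset (Σ j, Fin (n j))}
    (hy : IsFacet (partitionComplex n) y) : y.card = k + 1 := by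
  classical
  obtain ⟨hy, hall⟩ := (isFacet_partitionComplex_iff hn).1 hy
  have hinj : Set.InjOn Sigma.fst (y : Set (Σ j, Fin (n j))) := fun p hp q hq h => by
    by_contra hpq
    exact (mem_partitionComplex.1 hy).2 p hp q hq hpq h
  have himg : y.image Sigma.fst = Finset.univ :=
    Finset.eq_univ_iff_forall.2 fun j => Finset.mem_image.2 (hall j)
  rw [← Finset.card_image_of_injOn hinj, himg, Finset.card_univ, Fintype.card_fin]

/-- Facets are the transversals of the parts: if `x` meets every part, the images of one chosen
vertex per part form a facet. -/
theorem pullbackSet_partitionComplex {V : Type*} (G : AbstractSimplicialComplex V)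
    (hn : ∀ j, 0 < n j) (f : V → Σ j, Fin (n j)) :
    pullbackSet G f (partitionComplex n) = rainbowSet G (fun v => (f v).1) Finset.univ := by
  classical
  ext x
  refine and_congr_right fun _ => ⟨?_, fun h => ?_⟩
  · rintro ⟨y, hy, hyx⟩ j -
    obtain ⟨q, hq, rfl⟩ := ((isFacet_partitionComplex_iff hn).1 hy).2 j
    obtain ⟨p, hp, rfl⟩ := hyx hq
    exact ⟨p, hp, rfl⟩
  · choose p hp hpj using fun j => h j (Finset.mem_univ j)
    refine ⟨Finset.univ.image fun j => f (p j), (isFacet_partitionComplex_iff hn).2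
      ⟨mem_partitionComplex.2 ⟨Finset.univ_nonempty.image _, ?_⟩, fun j => ?_⟩, ?_⟩
    · intro q hq r hr hqr
      obtain ⟨i, -, rfl⟩ := Finset.mem_image.1 hq
      obtain ⟨j, -, rfl⟩ := Finset.mem_image.1 hr
      refine fun e => hqr ?_
      rw [show i = j from (hpj i).symm.trans (e.trans (hpj j))]
    · exact ⟨_, Finset.mem_image_of_mem _ (Finset.mem_univ j), hpj j⟩
    · intro q hq
      obtain ⟨i, -, rfl⟩ := Finset.mem_image.1 (Finset.mem_coe.1 hq)
      exact ⟨p i, hp i, rfl⟩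

end Partition

theorem pullbackComplex_faces_eq_iUnion {V W : Type*} (G : AbstractSimplicialComplex V)
    (f : V → W) (P : AbstractSimplicialComplex W) :
    (pullbackComplex G f P).faces =
      ⋃ y ∈ {y | IsFacet P y ∧ (y : Set W) ⊆ Set.range f}, (patchComplex G f y).faces := by
  ext c
  simp only [Set.mem_iUnion, exists_prop]
  constructor
  · rintro ⟨hc, hcU, hcl⟩
    obtain ⟨z, hz, hmin⟩ := c.exists_min_image Finset.card hc
    obtain ⟨-, y, hy, hyz⟩ := hcU hz
    refine ⟨y, ⟨hy, hyz.trans (Set.image_subset_range f z)⟩, hc, fun w hw => ⟨(hcU hw).1, ?_⟩, hcl⟩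
    refine hyz.trans (Set.image_mono (Finset.coe_subset.2 ?_))
    by_cases h : z = w
    · exact h.subset
    · rcases inclusionGraph_adj.1 (hcl hz hw h) with h | h
      · exact h.1
      · exact absurd (Finset.card_lt_card h) (hmin w hw).not_gt
  · rintro ⟨y, ⟨hy, -⟩, hc, hcy, hcl⟩
    exact ⟨hc, fun w hw => ⟨(hcy hw).1, y, hy, (hcy hw).2⟩, hcl⟩

end DiscreteManifold

theorem mainTheorem3 {V : Type*} [Finite V] (G : AbstractSimplicialComplex V) (d k : ℕ)
    (hG : DiscreteManifold.IsManifoldComplex (d : ℤ) G)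
    (n : Fin (k + 1) → ℕ) (hn : ∀ j, 0 < n j) (f : V → Σ j, Fin (n j))
    (hf : DiscreteManifold.IsOnto k f (DiscreteManifold.partitionComplex n)) :
    (DiscreteManifold.pullbackSet G f (DiscreteManifold.partitionComplex n) = ∅ ∨
      DiscreteManifold.IsManifold (DiscreteManifold.inclusionGraph V) ((d : ℤ) - k)
        (DiscreteManifold.pullbackSet G f (DiscreteManifold.partitionComplex n))) ∧
    (DiscreteManifold.pullbackComplex G f (DiscreteManifold.partitionComplex n)).faces =
      ⋃ y ∈ {y | DiscreteManifold.IsFacet (DiscreteManifold.partitionComplex n) y ∧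
          (y : Set (Σ j, Fin (n j))) ⊆ Set.range f},
        (DiscreteManifold.patchComplex G f y).faces ∧
    ∀ y, DiscreteManifold.IsFacet (DiscreteManifold.partitionComplex n) y →
      (y : Set (Σ j, Fin (n j))) ⊆ Set.range f →
      DiscreteManifold.patchSet G f y = ∅ ∨
        DiscreteManifold.IsManifoldWithBoundary (DiscreteManifold.inclusionGraph V)
          ((d : ℤ) - k) (DiscreteManifold.patchSet G f y) := by
  -- The manifold conditions are vacuous on the empty set, so the second alternative always holds.
  open DiscreteManifold in
  refine ⟨Or.inr fun x hx => ?_, pullbackComplex_faces_eq_iUnion G f _,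
    fun y hy _ => Or.inr fun x hx => ?_⟩
  · rw [pullbackSet_partitionComplex G hn f] at hx ⊢
    convert isSphere_unitSphere_rainbowSet hG Finset.univ_nonempty hx
      (fun _ _ => Finset.mem_univ _) using 1
    rw [Finset.card_univ, Fintype.card_fin]
    push_cast
    ring
  · rw [patchSet_eq_rainbowSet] at hx ⊢
    have hdim : (d : ℤ) - k - 1 = d - y.card := by
      rw [card_of_isFacet hn hy]
      push_cast
      ring
    rw [hdim]
    -- Interior simplices of the patch are those with `f(x) ⊆ y`; the others lie on its boundary.
    by_cases hg : ∀ p ∈ x, f p ∈ y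
    · exact Or.inl (isSphere_unitSphere_rainbowSet hG (mem_partitionComplex.1 hy.1).1 hx hg)
    · push Not at hg
      exact Or.inr (isBall_unitSphere_rainbowSet hG (mem_partitionComplex.1 hy.1).1 hx hg)
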